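/- Let $r,t,L\ge 1$ be integers, $\sigma>0$, let $\mathbf C^{(1)},\dots,\mathbf C^{(L)}$ be Hermitian positive definite $r\times r$ complex matrices and $\tilde{\mathbf C}^{(1)},\dots,\tilde{\mathbf C}^{(L)}$ Hermitian positive definite $t\times t$ complex matrices. Let $\mathcal C_1$ be the set of Hermitian nonnegative $t\times t$ matrices $\mathbf Q$ with $\frac1t\mathrm{Tr}\,\mathbf Q=1$. For $\kappa,\tilde\kappa\in\mathbb R^L$ write $\mathbf C(\tilde\kappa)=\sum_{l}\tilde\kappa_l\mathbf C^{(l)}$, $\tilde{\mathbf C}(\kappa)=\sum_l\kappa_l\tilde{\mathbf C}^{(l)}$, and for $\mathbf Q\in\mathcal C_1$ consider the canonical system of $2L$ equations, $1\le l\le L$, $$\kappa_l=\tfrac1t\mathrm{Tr}\big[\mathbf C^{(l)}\mathbf T(\tilde\kappa)\big],\qquad \tilde\kappa_l=\tfrac1t\mathrm{Tr}\big[\mathbf Q^{1/2}\tilde{\mathbf C}^{(l)}\mathbf Q^{1/2}\,\tilde{\mathbf T}(\kappa,\mathbf Q)\big],$$ $$\mathbf T(\tilde\kappa)=\Big(\sigma^2\big(\mathbf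 I+\mathbf C(\tilde\kappa)\big)\Big)^{-1},\qquad \tilde{\mathbf T}(\kappa,\mathbf Q)=\Big(\sigma^2\big(\mathbf I+\textstyle\sum_j\kappa_j\mathbf Q^{1/2}\tilde{\mathbf C}^{(j)}\mathbf Q^{1/2}\big)\Big)^{-1}.$$ For every $\mathbf Q\in\mathcal C_1$ this system has exactly one solution with all entries positive, denoted $(\delta(\mathbf Q),\tilde\delta(\mathbf Q))$. Define, with $|\cdot|$ the determinant, $$\overline I(\mathbf Q)=\log\big|\mathbf I+\mathbf C(\tilde\delta(\mathbf Q))\big|+\log\big|\mathbf I+\mathbf Q\tilde{\mathbf C}(\delta(\mathbf Q))\big|-\sigma^2t\sum_{l=1}^L\delta_l(\mathbf Q)\tilde\delta_l(\mathbf Q).$$ The function $\overline I$ has a unique maximizer $\overline{\mathbf Q}_*$ over $\mathcal C_1$. Put $\delta_*=\delta(\overline{\mathbf Q}_*)$. Then $\overline{\mathbf Q}_*$ is the unique solution of the standard waterfilling problem: maximize $\log|\mathbf I+\mathbf Q\tilde{\mathbf C}(\delta_*)|$ over $\mathbf Q\in\mathcal C_1$. -/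

import Mathlib

open scoped ComplexOrder MatrixOrder

noncomputable section

/-- The set `𝒞₁` of Hermitian nonnegative `t × t` matrices `Q` with `(1/t) Tr Q = 1`. -/
def powerSet (t : ℕ) : Set (Matrix (Fin t) (Fin t) ℂ) :=
  {Q | Q.PosSemidef ∧ (1 / (t : ℂ)) * Q.trace = 1}

/-- The real linear combination `∑ₗ κₗ A⁽ˡ⁾`; it gives both `C(κ̃)` and `C̃(κ)`. -/
def matComb {n L : ℕ} (A : Fin L → Matrix (Fin n) (Fin n) ℂ) (κ : Fin L → ℝ) :
    Matrix (Fin n) (Fin n) ℂ :=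
  ∑ l, (κ l : ℂ) • A l

/-- `log |A|`, where `|A|` is the determinant. It is only used for matrices whose
determinant is real and positive. -/
def logDet {n : ℕ} (A : Matrix (Fin n) (Fin n) ℂ) : ℝ :=
  Real.log A.det.re

/-- `T(κ̃) = (σ² (I + ∑ⱼ κ̃ⱼ C⁽ʲ⁾))⁻¹`. -/
def resolventR {r L : ℕ} (σ : ℝ) (C : Fin L → Matrix (Fin r) (Fin r) ℂ) (κt : Fin L → ℝ) :
    Matrix (Fin r) (Fin r) ℂ :=
  (((σ ^ 2 : ℝ) : ℂ) • (1 + ∑ j, (κt j : ℂ) • C j))⁻¹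

/-- `T̃(κ, Q) = (σ² (I + ∑ⱼ κⱼ Q^{1/2} C̃⁽ʲ⁾ Q^{1/2}))⁻¹`. -/
def resolventT {t L : ℕ} (σ : ℝ) (Ct : Fin L → Matrix (Fin t) (Fin t) ℂ) (κ : Fin L → ℝ)
    (Q : Matrix (Fin t) (Fin t) ℂ) : Matrix (Fin t) (Fin t) ℂ :=
  (((σ ^ 2 : ℝ) : ℂ) • (1 + ∑ j, (κ j : ℂ) • (CFC.sqrt Q * Ct j * CFC.sqrt Q)))⁻¹

/-- `fₗ(κ̃) = (1/t) Tr[C⁽ˡ⁾ T(κ̃)]`. -/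
def fR {r L : ℕ} (t : ℕ) (σ : ℝ) (C : Fin L → Matrix (Fin r) (Fin r) ℂ) (κt : Fin L → ℝ)
    (l : Fin L) : ℂ :=
  (1 / (t : ℂ)) * (C l * resolventR σ C κt).trace

/-- `f̃ₗ(κ, Q) = (1/t) Tr[Q^{1/2} C̃⁽ˡ⁾ Q^{1/2} T̃(κ, Q)]`. -/
def fT {t L : ℕ} (σ : ℝ) (Ct : Fin L → Matrix (Fin t) (Fin t) ℂ) (κ : Fin L → ℝ)
    (Q : Matrix (Fin t) (Fin t) ℂ) (l : Fin L) : ℂ :=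
  (1 / (t : ℂ)) * ((CFC.sqrt Q * Ct l * CFC.sqrt Q) * resolventT σ Ct κ Q).trace

/-- `(κ, κ̃)` is a positive solution of the canonical system at `Q`:
`κₗ = fₗ(κ̃)` and `κ̃ₗ = f̃ₗ(κ, Q)` for all `l`, all entries being positive. -/
def IsCanonicalSolution {r t L : ℕ} (σ : ℝ) (C : Fin L → Matrix (Fin r) (Fin r) ℂ)
    (Ct : Fin L → Matrix (Fin t) (Fin t) ℂ) (Q : Matrix (Fin t) (Fin t) ℂ)
    (p : (Fin L → ℝ) × (Fin L → ℝ)) : Prop :=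
  (∀ l, 0 < p.1 l) ∧ (∀ l, 0 < p.2 l) ∧
    (∀ l, (p.1 l : ℂ) = fR t σ C p.2 l) ∧ (∀ l, (p.2 l : ℂ) = fT σ Ct p.1 Q l)

/-- The positive solution `(δ(Q), δ̃(Q))` of the canonical system at `Q`
(a default value where there is none). -/
def canonicalSolution {r t L : ℕ} (σ : ℝ) (C : Fin L → Matrix (Fin r) (Fin r) ℂ)
    (Ct : Fin L → Matrix (Fin t) (Fin t) ℂ) (Q : Matrix (Fin t) (Fin t) ℂ) :
    (Fin L → ℝ) × (Fin L → ℝ) :=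
  Classical.epsilon (IsCanonicalSolution σ C Ct Q)

/-- `δ(Q)`. -/
def delta {r t L : ℕ} (σ : ℝ) (C : Fin L → Matrix (Fin r) (Fin r) ℂ)
    (Ct : Fin L → Matrix (Fin t) (Fin t) ℂ) (Q : Matrix (Fin t) (Fin t) ℂ) : Fin L → ℝ :=
  (canonicalSolution σ C Ct Q).1

/-- `δ̃(Q)`. -/
def deltaT {r t L : ℕ} (σ : ℝ) (C : Fin L → Matrix (Fin r) (Fin r) ℂ)
    (Ct : Fin L → Matrix (Fin t) (Fin t) ℂ) (Q : Matrix (Fin t) (Fin t) ℂ) : Fin L → ℝ :=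
  (canonicalSolution σ C Ct Q).2

/-- The large-system approximation
`Ī(Q) = log|I + ∑ₗ δ̃ₗ(Q) C⁽ˡ⁾| + log|I + Q ∑ₗ δₗ(Q) C̃⁽ˡ⁾| - σ² t ∑ₗ δₗ(Q) δ̃ₗ(Q)`. -/
def Ibar {r t L : ℕ} (σ : ℝ) (C : Fin L → Matrix (Fin r) (Fin r) ℂ)
    (Ct : Fin L → Matrix (Fin t) (Fin t) ℂ) (Q : Matrix (Fin t) (Fin t) ℂ) : ℝ :=
  logDet (1 + matComb C (deltaT σ C Ct Q)) + logDet (1 + Q * matComb Ct (delta σ C Ct Q))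
    - σ ^ 2 * t * ∑ l, delta σ C Ct Q l * deltaT σ C Ct Q l

/-- `x` is a maximizer of `f` over `S`. -/
def IsMaximizer {α : Type*} (f : α → ℝ) (S : Set α) (x : α) : Prop :=
  x ∈ S ∧ ∀ y ∈ S, f y ≤ f x

/-- `x` is the unique maximizer of `f` over `S`. -/
def IsUniqueMaximizer {α : Type*} (f : α → ℝ) (S : Set α) (x : α) : Prop :=
  x ∈ S ∧ ∀ y ∈ S, y ≠ x → f y < f x

end

/-!
Write `V(κ, κ̃, Q) = log|I + C(κ̃)| + log|I + Q C̃(κ)| - σ² t ∑ₗ κₗ κ̃ₗ`. The canonical system at `Q`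
says that `(κ, κ̃)` is a critical point of `V(·, ·, Q)`, and `Ī(Q)` is the critical value.

*Well-posedness.* Both halves of the system are given by maps which are antitone and decrease more
slowly than `κ ↦ κ⁻¹` along rays. Their composition is monotone on a box, so it has a fixed point
by Knaster–Tarski, and scalability makes the fixed point unique
(`IsAntitoneScalable.existsUnique`).

*Comparison principle.* If `(κ, κ̃)` solves the system at `Q` and `(κ', κ̃')` solves it at `Q'`, then
`V(κ, κ̃, Q) ≤ V(κ', κ̃', Q)` (`saddle_le_saddle`). Indeed, `x ↦ V(κ eˣ, κ̃ e⁻ˣ, Q)` is convex, because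
the bilinear term is constant and `log|I + ∑ₗ exp (xₗ) Aₗ|` is convex in `x` for nonnegative `Aₗ`; its
gradient vanishes at `x = 0` by the canonical system. Hence `V(κ, κ̃, Q) ≤ V(κ', κ κ̃ / κ', Q)`. As `V`
is concave in its second argument with critical point `κ̃'` when the first is `κ'`, the right-hand
side is at most `V(κ', κ̃', Q)`. The two tangent inequalities come from the spectral theorem:
`log λ ≤ λ - 1` on eigenvalues gives concavity (`Matrix.PosDef.logDet_le_tangent`), and Jensen's
inequality for `log` in an eigenbasis gives convexity in the exponents (`logDet_add_sum_le`).

*Conclusion.* So `Ī` is the pointwise minimum of the functions `V(δ(R), δ̃(R), ·)` with `R ∈ 𝒞₁`, each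
of which is continuous and strictly concave, and the one of index `R` touches `Ī` at `R`. Therefore
`Ī` is upper semicontinuous and strictly concave on the compact convex set `𝒞₁`, and has a unique
maximizer. At that maximizer `R`, a first-order argument along segments, using the continuity of
`δ` and `δ̃`, shows that `R` also maximizes `V(δ(R), δ̃(R), ·)`
(`isMaximizer_saddle_of_isMaximizer_Ibar`), which is the waterfilling objective up to a constant.
-/

open Matrix Filter Topology

/-! ### Traces, determinants and inverses of positive matrices -/

lemma Complex.ofReal_re_of_nonneg {z : ℂ} (hz : 0 ≤ z) : (z.re : ℂ) = z :=
  (Complex.eq_re_of_ofReal_le hz).symm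

lemma re_pos_of_pos {z : ℂ} (hz : 0 < z) : 0 < z.re := (Complex.pos_iff.mp hz).1

lemma logDet_mul {n : ℕ} {A B : Matrix (Fin n) (Fin n) ℂ} (hA : 0 < A.det) (hB : 0 < B.det) :
    logDet (A * B) = logDet A + logDet B := by
  have hA' := Complex.pos_iff.mp hA
  have hB' := Complex.pos_iff.mp hB
  rw [logDet, logDet, logDet, det_mul, Complex.mul_re, ← hA'.2, ← hB'.2, mul_zero, sub_zero,
    Real.log_mul hA'.1.ne' hB'.1.ne']

/-- Every positive definite matrix `X` is reduced to the identity by the congruence by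
`N = X^{-1/2}`. -/
lemma Matrix.PosDef.exists_whitening {n : ℕ} {X : Matrix (Fin n) (Fin n) ℂ} (hX : X.PosDef) :
    ∃ N : Matrix (Fin n) (Fin n) ℂ, N.IsHermitian ∧ N * N = X⁻¹ ∧ N * X * N = 1 := by
  have h0 : 0 ≤ X⁻¹ := nonneg_iff_posSemidef.mpr hX.inv.posSemidef
  have hS : CFC.sqrt X⁻¹ * CFC.sqrt X⁻¹ = X⁻¹ := CFC.sqrt_mul_sqrt_self _ h0
  refine ⟨CFC.sqrt X⁻¹, (nonneg_iff_posSemidef.mp (CFC.sqrt_nonneg X⁻¹)).isHermitian, hS, ?_⟩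
  rw [mul_eq_one_comm, ← mul_assoc, hS]
  exact nonsing_inv_mul X ((isUnit_iff_isUnit_det X).mp hX.isUnit)

lemma Matrix.PosSemidef.trace_mul_nonneg {n : ℕ} {A P : Matrix (Fin n) (Fin n) ℂ}
    (hA : A.PosSemidef) (hP : P.PosSemidef) : 0 ≤ (A * P).trace := by
  have h0 : 0 ≤ A := nonneg_iff_posSemidef.mpr hA
  have hS := CFC.sqrt_mul_sqrt_self A h0
  have hh := (nonneg_iff_posSemidef.mp (CFC.sqrt_nonneg A)).isHermitian
  have := (hP.mul_mul_conjTranspose_same (CFC.sqrt A)).trace_nonneg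
  rwa [hh.eq, trace_mul_comm, ← mul_assoc, hS] at this

lemma Matrix.PosSemidef.trace_mul_pos {n : ℕ} {A P : Matrix (Fin n) (Fin n) ℂ}
    (hA : A.PosSemidef) (hA0 : A ≠ 0) (hP : P.PosDef) : 0 < (A * P).trace := by
  refine lt_of_le_of_ne (hA.trace_mul_nonneg hP.posSemidef) fun h => hA0 ?_
  obtain ⟨N, hN, hNN, hNP⟩ := hP.inv.exists_whitening
  have hPu := (isUnit_iff_isUnit_det P).mp hP.isUnit
  rw [nonsing_inv_nonsing_inv P hPu] at hNN
  have h1 : (N * A * N).trace = 0 := by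
    rw [trace_mul_comm, ← mul_assoc, hNN, trace_mul_comm, ← h]
  have hpsd : (N * A * N).PosSemidef := by
    simpa [hN.eq] using hA.mul_mul_conjTranspose_same N
  have h2 := hpsd.trace_eq_zero_iff.mp h1
  calc A = (P⁻¹ * P) * A * (P * P⁻¹) := by
        rw [nonsing_inv_mul P hPu, mul_nonsing_inv P hPu, one_mul, mul_one]
    _ = P⁻¹ * N * (N * A * N) * N * P⁻¹ := by simp only [← hNN, mul_assoc]
    _ = 0 := by rw [h2]; simp

/-- Antitonicity of inversion, as an explicit identity: with `D = X - Y`,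
`Y⁻¹ - X⁻¹ = X⁻¹ (D + D Y⁻¹ D) X⁻¹`. -/
lemma Matrix.PosDef.inv_sub_inv {n : ℕ} {X Y : Matrix (Fin n) (Fin n) ℂ}
    (hX : X.PosDef) (hY : Y.PosDef) :
    Y⁻¹ - X⁻¹ = X⁻¹ * ((X - Y) + (X - Y) * Y⁻¹ * (X - Y)) * X⁻¹ := by
  have hXu := (isUnit_iff_isUnit_det X).mp hX.isUnit
  have hYu := (isUnit_iff_isUnit_det Y).mp hY.isUnit
  have h1 : (X - Y) + (X - Y) * Y⁻¹ * (X - Y) = X * Y⁻¹ * X - X := by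
    simp only [sub_mul, mul_sub, mul_nonsing_inv Y hYu, nonsing_inv_mul_cancel_right Y X hYu,
      one_mul]
    abel
  rw [h1, mul_sub, sub_mul, nonsing_inv_mul X hXu, one_mul, mul_assoc X, ← mul_assoc X⁻¹ X,
    nonsing_inv_mul X hXu, one_mul, mul_assoc, mul_nonsing_inv X hXu, mul_one]

lemma Matrix.PosDef.inv_sub_inv_posSemidef {n : ℕ} {X Y : Matrix (Fin n) (Fin n) ℂ}
    (hX : X.PosDef) (hY : Y.PosDef) (hD : (X - Y).PosSemidef) : (Y⁻¹ - X⁻¹).PosSemidef := by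
  rw [hX.inv_sub_inv hY]
  have h1 := hY.inv.posSemidef.mul_mul_conjTranspose_same (X - Y)
  rw [hD.isHermitian.eq] at h1
  have h2 := (hD.add h1).mul_mul_conjTranspose_same X⁻¹
  rwa [hX.inv.isHermitian.eq] at h2

lemma Matrix.PosDef.inv_sub_inv_posDef {n : ℕ} {X Y : Matrix (Fin n) (Fin n) ℂ}
    (hX : X.PosDef) (hY : Y.PosDef) (hD : (X - Y).PosDef) : (Y⁻¹ - X⁻¹).PosDef := by
  refine (PosSemidef.posDef_iff_isUnit (hX.inv_sub_inv_posSemidef hY hD.posSemidef)).mpr ?_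
  rw [hX.inv_sub_inv hY]
  have h1 := hY.inv.posSemidef.mul_mul_conjTranspose_same (X - Y)
  rw [hD.isHermitian.eq] at h1
  exact (hX.inv.isUnit.mul (hD.add_posSemidef h1).isUnit).mul hX.inv.isUnit

/-! ### Tangent inequalities for the log-determinant -/

lemma Matrix.PosDef.logDet_eq_sum_log {n : ℕ} {Z : Matrix (Fin n) (Fin n) ℂ} (hZ : Z.PosDef) :
    logDet Z = ∑ i, Real.log (hZ.1.eigenvalues i) := by
  rw [logDet, hZ.1.det_eq_prod_eigenvalues, ← Real.log_prod fun i _ => (hZ.eigenvalues_pos i).ne']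
  norm_cast

lemma Matrix.PosDef.logDet_le_trace_sub {n : ℕ} {Z : Matrix (Fin n) (Fin n) ℂ} (hZ : Z.PosDef) :
    logDet Z ≤ (Z - 1).trace.re := by
  rw [hZ.logDet_eq_sum_log, trace_sub, hZ.1.trace_eq_sum_eigenvalues]
  have := Finset.sum_le_sum fun i (_ : i ∈ Finset.univ) =>
    Real.log_le_sub_one_of_pos (hZ.eigenvalues_pos i)
  simpa using this

lemma Matrix.PosDef.logDet_lt_trace_sub {n : ℕ} {Z : Matrix (Fin n) (Fin n) ℂ} (hZ : Z.PosDef)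
    (hne : Z ≠ 1) : logDet Z < (Z - 1).trace.re := by
  have hex : ∃ i, hZ.1.eigenvalues i ≠ 1 := by
    by_contra! h
    apply hne
    have h2 := hZ.1.spectral_theorem
    have h3 : (RCLike.ofReal ∘ hZ.1.eigenvalues : Fin n → ℂ) = fun _ => 1 := by
      funext i; simp [h i]
    rw [h3, diagonal_one, map_one] at h2
    exact h2
  obtain ⟨i, hi⟩ := hex
  rw [hZ.logDet_eq_sum_log, trace_sub, hZ.1.trace_eq_sum_eigenvalues]
  have := Finset.sum_lt_sum (fun i (_ : i ∈ Finset.univ) =>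
    Real.log_le_sub_one_of_pos (hZ.eigenvalues_pos i))
    ⟨i, Finset.mem_univ i, Real.log_lt_sub_one_of_pos (hZ.eigenvalues_pos i) hi⟩
  simpa using this

lemma logDet_congr_whitening {n : ℕ} {X Y N : Matrix (Fin n) (Fin n) ℂ} (hX : X.PosDef)
    (hY : Y.PosDef) (hN : N * N = X⁻¹) : logDet (N * Y * N) = logDet Y - logDet X := by
  have h1 : logDet (N * Y * N) = logDet (X⁻¹ * Y) := by
    rw [logDet, logDet, ← hN, det_mul, det_mul, det_mul, det_mul]; congr 2; ring
  have h2 : logDet (X * X⁻¹) = 0 := by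
    rw [mul_nonsing_inv X ((isUnit_iff_isUnit_det X).mp hX.isUnit)]; simp [logDet]
  rw [logDet_mul hX.det_pos hX.inv.det_pos] at h2
  rw [h1, logDet_mul hX.inv.det_pos hY.det_pos]
  linarith

lemma Matrix.PosDef.whitening_posDef {n : ℕ} {X Y N : Matrix (Fin n) (Fin n) ℂ} (hX : X.PosDef)
    (hY : Y.PosDef) (hNh : N.IsHermitian) (hN : N * N = X⁻¹) : (N * Y * N).PosDef := by
  have hNu : IsUnit N := isUnit_of_mul_isUnit_left (hN ▸ hX.inv.isUnit)
  have hpsd : (N * Y * N).PosSemidef := by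
    simpa [hNh.eq] using hY.posSemidef.mul_mul_conjTranspose_same N
  exact hpsd.posDef_iff_isUnit.mpr ((hNu.mul hY.isUnit).mul hNu)

/-- Concavity of `log det`: its graph lies below its tangent plane at `X`. -/
lemma Matrix.PosDef.logDet_le_tangent {n : ℕ} {X Y : Matrix (Fin n) (Fin n) ℂ}
    (hX : X.PosDef) (hY : Y.PosDef) :
    logDet Y ≤ logDet X + ((Y - X) * X⁻¹).trace.re := by
  obtain ⟨N, hNh, hNN, hNX⟩ := hX.exists_whitening
  have h := (hX.whitening_posDef hY hNh hNN).logDet_le_trace_sub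
  rw [logDet_congr_whitening hX hY hNN, ← hNX, ← sub_mul, ← mul_sub, mul_assoc, trace_mul_comm,
    mul_assoc, hNN] at h
  linarith

/-- Strict concavity of `log det`. -/
lemma Matrix.PosDef.logDet_lt_tangent {n : ℕ} {X Y : Matrix (Fin n) (Fin n) ℂ}
    (hX : X.PosDef) (hY : Y.PosDef) (hne : Y ≠ X) :
    logDet Y < logDet X + ((Y - X) * X⁻¹).trace.re := by
  obtain ⟨N, hNh, hNN, hNX⟩ := hX.exists_whitening
  have hNu : IsUnit N := isUnit_of_mul_isUnit_left (hNN ▸ hX.inv.isUnit)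
  have h := (hX.whitening_posDef hY hNh hNN).logDet_lt_trace_sub fun h => hne <| by
    rw [← hNX] at h
    exact hNu.mul_left_cancel (hNu.mul_right_cancel h)
  rw [logDet_congr_whitening hX hY hNN, ← hNX, ← sub_mul, ← mul_sub, mul_assoc, trace_mul_comm,
    mul_assoc, hNN] at h
  linarith

/-- Jensen's inequality for a resolution of the identity `∑ₗ Bₗ = I`: in an orthonormal
eigenbasis of `∑ₗ wₗ Bₗ`, each eigenvalue is an average of the `wₗ` with the diagonal entries of
the `Bₗ` as weights. -/
lemma sum_trace_mul_log_le_logDet {n : ℕ} {ι : Type*} [Fintype ι]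
    {B : ι → Matrix (Fin n) (Fin n) ℂ} (hB : ∀ l, (B l).PosSemidef) (hsum : ∑ l, B l = 1)
    {w : ι → ℝ} (hw : ∀ l, 0 < w l) (hM : (∑ l, (w l : ℂ) • B l).PosDef) :
    ∑ l, (B l).trace.re * Real.log (w l) ≤ logDet (∑ l, (w l : ℂ) • B l) := by
  set M := ∑ l, (w l : ℂ) • B l with hMdef
  let U : Matrix (Fin n) (Fin n) ℂ := hM.1.eigenvectorUnitary
  have hUU : Uᴴ * U = 1 := Unitary.coe_star_mul_self hM.1.eigenvectorUnitary
  have hUU' : U * Uᴴ = 1 := mul_eq_one_comm.mp hUU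
  let D : ι → Matrix (Fin n) (Fin n) ℂ := fun l => Uᴴ * B l * U
  have hD : ∀ l, (D l).PosSemidef := fun l => (hB l).conjTranspose_mul_mul_same U
  have hDr : ∀ l i, (((D l i i).re : ℝ) : ℂ) = D l i i := fun l i =>
    Complex.ofReal_re_of_nonneg (hD l).diag_nonneg
  have htr : ∀ l, (B l).trace.re = ∑ i, (D l i i).re := by
    intro l
    have : (B l).trace = (D l).trace := by
      simp only [D]
      rw [trace_mul_comm, ← mul_assoc, hUU', one_mul]
    rw [this, trace, Complex.re_sum]; rfl
  have hone : ∀ i, ∑ l, (D l i i).re = 1 := by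
    intro i
    have h1 : ∑ l, D l = 1 := by
      simp only [D, ← Finset.sum_mul, ← Finset.mul_sum, hsum, mul_one, hUU]
    have h2 := congrFun (congrFun h1 i) i
    rw [Matrix.sum_apply, one_apply_eq] at h2
    rw [← Complex.re_sum, h2, Complex.one_re]
  have heig : ∀ i, ∑ l, (D l i i).re * w l = hM.1.eigenvalues i := by
    intro i
    have h1 : ∑ l, (w l : ℂ) • D l = diagonal (RCLike.ofReal ∘ hM.1.eigenvalues) := by
      rw [← hM.1.conjStarAlgAut_star_eigenvectorUnitary, Unitary.conjStarAlgAut_apply]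
      simp only [D, hMdef, Finset.mul_sum, Finset.sum_mul, mul_smul_comm, smul_mul_assoc, U]
      simp [star_eq_conjTranspose]
    have h2 := congrFun (congrFun h1 i) i
    rw [Matrix.sum_apply, diagonal_apply_eq] at h2
    have h3 := congrArg Complex.re h2
    simpa [mul_comm] using h3
  rw [hM.logDet_eq_sum_log]
  simp only [htr, Finset.sum_mul]
  rw [Finset.sum_comm]
  refine Finset.sum_le_sum fun i _ => ?_
  have := strictConcaveOn_log_Ioi.concaveOn.le_map_sum (t := Finset.univ)
    (w := fun l => (D l i i).re) (p := w)
    (fun l _ => (Complex.nonneg_iff.mp (hD l).diag_nonneg).1) (hone i) (fun l _ => hw l)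
  simpa [heig] using this

/-- Convexity of `x ↦ log det (∑ₗ exp (xₗ) Aₗ)` for nonnegative matrices `Aₗ`, as a tangent
inequality at a point where `∑ₗ exp (xₗ) Aₗ = X`; the `Aₗ` are scaled so that this point is
`x = 0`, and `wₗ` is `exp (xₗ)`. -/
lemma logDet_add_sum_le {n : ℕ} {ι : Type*} [Fintype ι]
    {A : ι → Matrix (Fin n) (Fin n) ℂ} (hA : ∀ l, (A l).PosSemidef)
    {X : Matrix (Fin n) (Fin n) ℂ} (hX : X.PosDef) (hsum : ∑ l, A l = X)
    {w : ι → ℝ} (hw : ∀ l, 0 < w l) (hM : (∑ l, (w l : ℂ) • A l).PosDef) :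
    logDet X + ∑ l, (A l * X⁻¹).trace.re * Real.log (w l) ≤ logDet (∑ l, (w l : ℂ) • A l) := by
  obtain ⟨N, hNh, hNN, hNX⟩ := hX.exists_whitening
  have hcomb : ∑ l, (w l : ℂ) • (N * A l * N) = N * (∑ l, (w l : ℂ) • A l) * N := by
    simp only [Finset.mul_sum, Finset.sum_mul, mul_smul_comm, smul_mul_assoc]
  have h := sum_trace_mul_log_le_logDet (B := fun l => N * A l * N) (w := w)
    (fun l => by simpa [hNh.eq] using (hA l).mul_mul_conjTranspose_same N)
    (by rw [← Finset.sum_mul, ← Finset.mul_sum, hsum, hNX]) hw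
    (hcomb ▸ hX.whitening_posDef hM hNh hNN)
  rw [hcomb, logDet_congr_whitening hX hM hNN] at h
  have htr : ∀ l, (N * A l * N).trace = (A l * X⁻¹).trace := fun l => by
    rw [mul_assoc, trace_mul_comm, mul_assoc, hNN]
  simp only [htr] at h
  linarith

/-! ### Coupled fixed points of antitone scalable maps -/

/-- Antitone maps between nonnegative vectors with positive values which decrease strictly slower
than `κ ↦ κ⁻¹` along every ray. The composition of two of them is a standard interference
function in the sense of Yates. -/
structure IsAntitoneScalable {L : ℕ} (f : (Fin L → ℝ) → Fin L → ℝ) : Prop where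
  pos : ∀ κ, 0 ≤ κ → ∀ l, 0 < f κ l
  anti : ∀ κ κ', 0 ≤ κ → κ ≤ κ' → f κ' ≤ f κ
  scale : ∀ κ (a : ℝ), 0 ≤ κ → 1 < a → ∀ l, f κ l < a * f (a • κ) l

/-- Knaster–Tarski for the monotone map `f ∘ g` on the box `[0, f 0]`. -/
lemma IsAntitoneScalable.exists_fixed {L : ℕ} {f g : (Fin L → ℝ) → Fin L → ℝ}
    (hf : IsAntitoneScalable f) (hg : IsAntitoneScalable g) :
    ∃ κ, 0 ≤ κ ∧ f (g κ) = κ := by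
  have g0 : ∀ κ, 0 ≤ κ → 0 ≤ g κ := fun κ h l => (hg.pos κ h l).le
  have f0 : ∀ κ, 0 ≤ κ → 0 ≤ f κ := fun κ h l => (hf.pos κ h l).le
  have mono : ∀ κ κ', 0 ≤ κ → κ ≤ κ' → f (g κ) ≤ f (g κ') := fun κ κ' h h' =>
    hf.anti _ _ (g0 κ' (h.trans h')) (hg.anti κ κ' h h')
  let S : Set (Fin L → ℝ) := {κ | 0 ≤ κ ∧ κ ≤ f 0 ∧ κ ≤ f (g κ)}
  have hS0 : (0 : Fin L → ℝ) ∈ S := ⟨le_rfl, f0 0 le_rfl, f0 _ (g0 0 le_rfl)⟩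
  have hlub : IsLUB S (sSup S) := isLUB_csSup ⟨0, hS0⟩ ⟨f 0, fun κ h => h.2.1⟩
  have hs0 : 0 ≤ sSup S := hlub.1 hS0
  have h1 : sSup S ≤ f (g (sSup S)) :=
    hlub.2 fun κ h => h.2.2.trans (mono κ _ h.1 (hlub.1 h))
  have h2 : f (g (sSup S)) ∈ S :=
    ⟨f0 _ (g0 _ hs0), hf.anti 0 _ le_rfl (g0 _ hs0), mono _ _ hs0 h1⟩
  exact ⟨_, hs0, le_antisymm (hlub.1 h2) h1⟩

/-- If `κ'` exceeds `κ` somewhere, let `a > 1` be the largest ratio `κ'ₗ / κₗ`; then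
`κ' ≤ a κ`, and scalability turns this into the strict inequality `κ' < a κ`. -/
lemma IsAntitoneScalable.fixed_le {L : ℕ} {f g : (Fin L → ℝ) → Fin L → ℝ}
    (hf : IsAntitoneScalable f) (hg : IsAntitoneScalable g) {κ κ' : Fin L → ℝ}
    (h0 : ∀ l, 0 < κ l) (h0' : ∀ l, 0 < κ' l) (hfix : f (g κ) = κ) (hfix' : f (g κ') = κ') :
    κ' ≤ κ := by
  by_contra hle
  obtain ⟨l₀, hl₀⟩ : ∃ l, κ l < κ' l := by
    by_contra! h; exact hle h
  have : Nonempty (Fin L) := ⟨l₀⟩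
  obtain ⟨m, hm⟩ := Finite.exists_max fun l => κ' l / κ l
  set a := κ' m / κ m with ha
  have ha1 : 1 < a := lt_of_lt_of_le ((one_lt_div (h0 l₀)).mpr hl₀) (hm l₀)
  have ha0 : 0 < a := one_pos.trans ha1
  have hle' : κ' ≤ a • κ := fun l => by
    have := (div_le_iff₀ (h0 l)).mp (hm l)
    simpa using this
  have hκ : 0 ≤ κ := fun l => (h0 l).le
  have hκ' : 0 ≤ κ' := fun l => (h0' l).le
  have hg1 : a⁻¹ • g κ ≤ g κ' := fun l => by
    have h1 := hg.scale κ a hκ ha1 l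
    have h2 := hg.anti κ' (a • κ) hκ' hle' l
    have h3 := mul_le_mul_of_nonneg_left h2 ha0.le
    rw [Pi.smul_apply, smul_eq_mul, inv_mul_le_iff₀ ha0]
    linarith
  have hpos : 0 ≤ a⁻¹ • g κ := fun l => by
    have := (hg.pos κ hκ l).le
    simp only [Pi.zero_apply, Pi.smul_apply, smul_eq_mul]
    positivity
  have h1 := hf.anti _ _ hpos hg1 m
  have h2 := hf.scale _ a hpos ha1 m
  rw [smul_smul, mul_inv_cancel₀ ha0.ne', one_smul, hfix] at h2
  rw [hfix'] at h1
  have h3 : a * κ m = κ' m := div_mul_cancel₀ _ (h0 m).ne'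
  linarith

lemma IsAntitoneScalable.existsUnique {L : ℕ} {f g : (Fin L → ℝ) → Fin L → ℝ}
    (hf : IsAntitoneScalable f) (hg : IsAntitoneScalable g) :
    ∃! p : (Fin L → ℝ) × (Fin L → ℝ),
      (∀ l, 0 < p.1 l) ∧ (∀ l, 0 < p.2 l) ∧ p.1 = f p.2 ∧ p.2 = g p.1 := by
  obtain ⟨κ, hκ, hfix⟩ := hf.exists_fixed hg
  have hg0 := hg.pos κ hκ
  have hf0 := hf.pos (g κ) fun l => (hg0 l).le
  rw [hfix] at hf0
  refine ⟨(κ, g κ), ⟨hf0, hg0, hfix.symm, rfl⟩, ?_⟩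
  rintro ⟨x, y⟩ ⟨hx, hy, hxy, hyx⟩
  dsimp only at hx hy hxy hyx
  subst hyx
  have : x = κ := le_antisymm (hf.fixed_le hg hf0 hx hfix hxy.symm)
    (hf.fixed_le hg hx hf0 hxy.symm hfix)
  rw [this]

/-! ### The maps of the canonical system -/

/-- The vector with entries `c Tr[Aₗ (I + ∑ⱼ κⱼ Aⱼ)⁻¹]`, which is `c` times the gradient at `κ` of
`log |I + ∑ⱼ κⱼ Aⱼ|`. For `c = 1 / (σ² t)` it is either half of the canonical system. -/
noncomputable def response {n L : ℕ} (c : ℝ) (A : Fin L → Matrix (Fin n) (Fin n) ℂ)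
    (κ : Fin L → ℝ) (l : Fin L) : ℝ :=
  c * (A l * (1 + matComb A κ)⁻¹).trace.re

lemma matComb_posSemidef {n L : ℕ} {A : Fin L → Matrix (Fin n) (Fin n) ℂ}
    (hA : ∀ l, (A l).PosSemidef) {κ : Fin L → ℝ} (hκ : 0 ≤ κ) : (matComb A κ).PosSemidef :=
  posSemidef_sum _ fun l _ => (hA l).smul (by exact_mod_cast hκ l)

lemma matComb_posDef {n L : ℕ} (hL : 0 < L) {A : Fin L → Matrix (Fin n) (Fin n) ℂ}
    (hA : ∀ l, (A l).PosDef) {κ : Fin L → ℝ} (hκ : ∀ l, 0 < κ l) : (matComb A κ).PosDef :=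
  posDef_sum ⟨⟨0, hL⟩, Finset.mem_univ _⟩ fun l _ => (hA l).smul (by exact_mod_cast hκ l)

lemma one_add_matComb_posDef {n L : ℕ} {A : Fin L → Matrix (Fin n) (Fin n) ℂ}
    (hA : ∀ l, (A l).PosSemidef) {κ : Fin L → ℝ} (hκ : 0 ≤ κ) : (1 + matComb A κ).PosDef :=
  PosDef.one.add_posSemidef (matComb_posSemidef hA hκ)

lemma fR_eq_response {n L : ℕ} (t : ℕ) {σ : ℝ} (hσ : 0 < σ)
    {A : Fin L → Matrix (Fin n) (Fin n) ℂ}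
    (hA : ∀ l, (A l).PosSemidef) {κ : Fin L → ℝ} (hκ : 0 ≤ κ) (l : Fin L) :
    fR t σ A κ l = (response (σ ^ 2 * t)⁻¹ A κ l : ℂ) := by
  have hX := one_add_matComb_posDef hA hκ
  have hu := (isUnit_iff_isUnit_det _).mp hX.isUnit
  have hre := Complex.ofReal_re_of_nonneg ((hA l).trace_mul_nonneg hX.inv.posSemidef)
  have hσ' : ((σ ^ 2 : ℝ) : ℂ) ≠ 0 := by exact_mod_cast (pow_pos hσ 2).ne'
  have hres : resolventR σ A κ = ((σ ^ 2 : ℝ) : ℂ)⁻¹ • (1 + matComb A κ)⁻¹ := by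
    have := Matrix.inv_smul' (A := 1 + matComb A κ) (Units.mk0 _ hσ') hu
    exact this
  rw [fR, hres, response, Complex.ofReal_mul, hre, mul_smul_comm, trace_smul, smul_eq_mul]
  push_cast
  rw [mul_inv, one_div]
  ring

lemma re_trace_mul_le {n : ℕ} {A P R : Matrix (Fin n) (Fin n) ℂ} (hA : A.PosSemidef)
    (h : (R - P).PosSemidef) : (A * P).trace.re ≤ (A * R).trace.re := by
  have := (Complex.nonneg_iff.mp (hA.trace_mul_nonneg h)).1
  rw [mul_sub, trace_sub, Complex.sub_re] at this
  linarith

lemma re_trace_mul_lt {n : ℕ} {A P R : Matrix (Fin n) (Fin n) ℂ} (hA : A.PosSemidef) (hA0 : A ≠ 0)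
    (h : (R - P).PosDef) : (A * P).trace.re < (A * R).trace.re := by
  have := re_pos_of_pos (hA.trace_mul_pos hA0 h)
  rw [mul_sub, trace_sub, Complex.sub_re] at this
  linarith

lemma matComb_sub {n L : ℕ} (A : Fin L → Matrix (Fin n) (Fin n) ℂ) (κ κ' : Fin L → ℝ) :
    matComb A κ' - matComb A κ = matComb A (κ' - κ) := by
  simp [matComb, ← Finset.sum_sub_distrib, sub_smul]

lemma matComb_smul {n L : ℕ} (A : Fin L → Matrix (Fin n) (Fin n) ℂ) (a : ℝ) (κ : Fin L → ℝ) :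
    matComb A (a • κ) = (a : ℂ) • matComb A κ := by
  simp only [matComb, Finset.smul_sum, smul_smul, Pi.smul_apply, smul_eq_mul, Complex.ofReal_mul]

lemma isAntitoneScalable_response {n L : ℕ} {c : ℝ} (hc : 0 < c)
    {A : Fin L → Matrix (Fin n) (Fin n) ℂ} (hA : ∀ l, (A l).PosSemidef) (hA0 : ∀ l, A l ≠ 0) :
    IsAntitoneScalable (response c A) where
  pos κ hκ l := mul_pos hc <| re_pos_of_pos <|
    (hA l).trace_mul_pos (hA0 l) (one_add_matComb_posDef hA hκ).inv
  anti κ κ' hκ h l := by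
    refine mul_le_mul_of_nonneg_left (re_trace_mul_le (hA l) ?_) hc.le
    refine (one_add_matComb_posDef hA (hκ.trans h)).inv_sub_inv_posSemidef
      (one_add_matComb_posDef hA hκ) ?_
    rw [add_sub_add_left_eq_sub, matComb_sub]
    exact matComb_posSemidef hA (sub_nonneg.mpr h)
  scale κ a hκ ha l := by
    have ha0 : 0 < a := one_pos.trans ha
    have haC : (a : ℂ) ≠ 0 := by exact_mod_cast ha0.ne'
    have ha1 : a⁻¹ < 1 := inv_lt_one_of_one_lt₀ ha
    -- `a (I + a C)⁻¹ = (a⁻¹ I + C)⁻¹`, and `a⁻¹ I + C < I + C`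
    have hY : ((a : ℂ)⁻¹ • (1 + matComb A (a • κ))).PosDef := by
      refine (one_add_matComb_posDef hA (smul_nonneg ha0.le hκ)).smul ?_
      rw [← Complex.ofReal_inv]; exact_mod_cast inv_pos.mpr ha0
    have hD : (1 + matComb A κ - (a : ℂ)⁻¹ • (1 + matComb A (a • κ))).PosDef := by
      have : 1 + matComb A κ - (a : ℂ)⁻¹ • (1 + matComb A (a • κ)) =
          ((1 - a⁻¹ : ℝ) : ℂ) • (1 : Matrix (Fin n) (Fin n) ℂ) := by
        rw [matComb_smul, smul_add, smul_smul, inv_mul_cancel₀ haC, one_smul]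
        push_cast
        rw [sub_smul, one_smul]
        abel
      rw [this]
      exact PosDef.one.smul (by exact_mod_cast sub_pos.mpr ha1)
    have h := re_trace_mul_lt (hA l) (hA0 l)
      ((one_add_matComb_posDef hA hκ).inv_sub_inv_posDef hY hD)
    have hu := (isUnit_iff_isUnit_det _).mp
      (one_add_matComb_posDef hA (smul_nonneg ha0.le hκ)).isUnit
    have hinv : ((a : ℂ)⁻¹ • (1 + matComb A (a • κ)))⁻¹ =
        (a : ℂ) • (1 + matComb A (a • κ))⁻¹ := by
      have := Matrix.inv_smul' (A := 1 + matComb A (a • κ)) (Units.mk0 _ (inv_ne_zero haC)) hu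
      rw [Units.smul_def, Units.val_mk0] at this
      rw [this, Units.smul_def, Units.val_inv_eq_inv_val, Units.val_mk0, inv_inv]
    rw [hinv, mul_smul_comm, trace_smul, smul_eq_mul, Complex.re_ofReal_mul] at h
    have := mul_lt_mul_of_pos_left h hc
    simp only [response]
    linarith

/-- Concavity in `κ` of `log |I + ∑ₗ κₗ Aₗ|`, with the gradient read off from `response`. -/
lemma logDet_matComb_le {n L : ℕ} {b : ℝ} (hb : 0 < b) {A : Fin L → Matrix (Fin n) (Fin n) ℂ}
    (hA : ∀ l, (A l).PosSemidef) {κ κ' : Fin L → ℝ} (hκ : 0 ≤ κ) (hκ' : 0 ≤ κ') :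
    logDet (1 + matComb A κ') ≤
      logDet (1 + matComb A κ) + b * ∑ l, (κ' l - κ l) * response b⁻¹ A κ l := by
  have h := (one_add_matComb_posDef hA hκ).logDet_le_tangent (one_add_matComb_posDef hA hκ')
  rw [add_sub_add_left_eq_sub, matComb_sub, matComb.eq_def A (κ' - κ), Finset.sum_mul, trace_sum,
    Complex.re_sum] at h
  convert h using 2
  rw [Finset.mul_sum]
  refine Finset.sum_congr rfl fun l _ => ?_
  rw [smul_mul_assoc, trace_smul, smul_eq_mul, Complex.re_ofReal_mul, response, Pi.sub_apply]
  field_simp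

/-- Convexity in `x` of `log |I + ∑ₗ exp (xₗ) κₗ Aₗ|`, as a tangent inequality at `x = 0`, with `wₗ`
in place of `exp (xₗ)`. -/
lemma le_logDet_matComb_mul {n L : ℕ} {b : ℝ} (hb : 0 < b)
    {A : Fin L → Matrix (Fin n) (Fin n) ℂ}
    (hA : ∀ l, (A l).PosSemidef) {κ w : Fin L → ℝ} (hκ : 0 ≤ κ) (hw : ∀ l, 0 < w l) :
    logDet (1 + matComb A κ) + b * ∑ l, κ l * response b⁻¹ A κ l * Real.log (w l) ≤
      logDet (1 + matComb A (w * κ)) := by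
  -- the summand `I` is the member `none` of the family, with constant weight `1`
  let B : Option (Fin L) → Matrix (Fin n) (Fin n) ℂ := fun o => o.elim 1 fun l => (κ l : ℂ) • A l
  let v : Option (Fin L) → ℝ := fun o => o.elim 1 w
  have hB : ∀ o, (B o).PosSemidef := by
    rintro (_ | l)
    · exact PosSemidef.one
    · exact (hA l).smul (by exact_mod_cast hκ l)
  have hv : ∀ o, 0 < v o := by
    rintro (_ | l)
    · exact one_pos
    · exact hw l
  have hsum : ∑ o, B o = 1 + matComb A κ := by rw [Fintype.sum_option]; rfl
  have hsum' : ∑ o, (v o : ℂ) • B o = 1 + matComb A (w * κ) := by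
    rw [Fintype.sum_option]
    simp only [B, v, Option.elim_none, Option.elim_some, Complex.ofReal_one, one_smul, smul_smul,
      matComb, Pi.mul_apply, Complex.ofReal_mul]
  have hwκ : 0 ≤ w * κ := fun l => mul_nonneg (hw l).le (hκ l)
  have h := logDet_add_sum_le hB (one_add_matComb_posDef hA hκ) hsum hv
    (hsum' ▸ one_add_matComb_posDef hA hwκ)
  rw [hsum', Fintype.sum_option] at h
  simp only [B, v, Option.elim_none, Option.elim_some, Real.log_one, mul_zero, zero_add] at h
  convert h using 2
  rw [Finset.mul_sum]
  refine Finset.sum_congr rfl fun l _ => ?_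
  rw [smul_mul_assoc, trace_smul, smul_eq_mul, Complex.re_ofReal_mul, response]
  field_simp

/-! ### Well-posedness of the canonical system -/

/-- The family `Q^{1/2} C̃⁽ˡ⁾ Q^{1/2}`. -/
noncomputable def sandwich {t L : ℕ} (Ct : Fin L → Matrix (Fin t) (Fin t) ℂ)
    (Q : Matrix (Fin t) (Fin t) ℂ) (l : Fin L) : Matrix (Fin t) (Fin t) ℂ :=
  CFC.sqrt Q * Ct l * CFC.sqrt Q

section sandwich
variable {t L : ℕ} {Ct : Fin L → Matrix (Fin t) (Fin t) ℂ} {Q : Matrix (Fin t) (Fin t) ℂ}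

lemma sqrt_isHermitian (Q : Matrix (Fin t) (Fin t) ℂ) : (CFC.sqrt Q).IsHermitian :=
  (nonneg_iff_posSemidef.mp (CFC.sqrt_nonneg Q)).isHermitian

lemma Matrix.PosSemidef.sqrt_mul_sqrt (hQ : Q.PosSemidef) : CFC.sqrt Q * CFC.sqrt Q = Q :=
  CFC.sqrt_mul_sqrt_self Q (nonneg_iff_posSemidef.mpr hQ)

lemma sandwich_posSemidef (hCt : ∀ l, (Ct l).PosDef) (l : Fin L) :
    (sandwich Ct Q l).PosSemidef := by
  have := (hCt l).posSemidef.mul_mul_conjTranspose_same (CFC.sqrt Q)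
  rwa [(sqrt_isHermitian Q).eq] at this

lemma sandwich_ne_zero (hCt : ∀ l, (Ct l).PosDef) (hQ : Q.PosSemidef) (hQ0 : Q ≠ 0) (l : Fin L) :
    sandwich Ct Q l ≠ 0 := by
  intro h
  have h1 := hQ.trace_mul_pos hQ0 (hCt l)
  have h2 : (sandwich Ct Q l).trace = (Q * Ct l).trace := by
    rw [sandwich, trace_mul_comm, ← mul_assoc, hQ.sqrt_mul_sqrt]
  rw [← h2, h, trace_zero] at h1
  exact lt_irrefl _ h1

lemma matComb_sandwich (κ : Fin L → ℝ) :
    matComb (sandwich Ct Q) κ = CFC.sqrt Q * matComb Ct κ * CFC.sqrt Q := by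
  simp only [matComb, sandwich, Finset.mul_sum, Finset.sum_mul, mul_smul_comm, smul_mul_assoc]

lemma det_one_add_mul_eq (hQ : Q.PosSemidef) (κ : Fin L → ℝ) :
    (1 + Q * matComb Ct κ).det = (1 + matComb (sandwich Ct Q) κ).det := by
  rw [matComb_sandwich, det_one_add_mul_comm (CFC.sqrt Q * matComb Ct κ), ← mul_assoc,
    hQ.sqrt_mul_sqrt]

lemma det_one_add_mul_pos (hCt : ∀ l, (Ct l).PosDef) (hQ : Q.PosSemidef) {κ : Fin L → ℝ}
    (hκ : 0 ≤ κ) : 0 < (1 + Q * matComb Ct κ).det := by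
  rw [det_one_add_mul_eq hQ]
  exact (one_add_matComb_posDef (sandwich_posSemidef hCt) hκ).det_pos

/-- The square roots of `Q` can be moved out of the resolvent, which makes the dependence of the
canonical system on `Q` visibly continuous. -/
lemma response_sandwich (hCt : ∀ l, (Ct l).PosDef) (hQ : Q.PosSemidef) {κ : Fin L → ℝ}
    (hκ : 0 ≤ κ) (c : ℝ) (l : Fin L) :
    response c (sandwich Ct Q) κ l =
      c * (Ct l * Q * (1 + matComb Ct κ * Q)⁻¹).trace.re := by
  set S := CFC.sqrt Q with hS
  have hSS : S * S = Q := hQ.sqrt_mul_sqrt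
  set X := 1 + matComb (sandwich Ct Q) κ with hX
  set Y := 1 + matComb Ct κ * Q with hY
  have hXu : IsUnit X.det := (isUnit_iff_isUnit_det _).mp
    (one_add_matComb_posDef (sandwich_posSemidef hCt) hκ).isUnit
  have hYu : IsUnit Y.det := by
    rw [hY, det_one_add_mul_comm]
    exact (det_one_add_mul_pos hCt hQ hκ).ne'.isUnit
  have hcomm : S * Y = X * S := by
    simp only [hX, hY, matComb_sandwich, ← hS, mul_add, add_mul, mul_one, one_mul, mul_assoc, hSS]
  have hinv : X⁻¹ * S = S * Y⁻¹ := by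
    calc X⁻¹ * S = X⁻¹ * (S * Y) * Y⁻¹ := by
          rw [mul_assoc, mul_assoc S, mul_nonsing_inv Y hYu, mul_one]
      _ = S * Y⁻¹ := by rw [hcomm, ← mul_assoc, nonsing_inv_mul X hXu, one_mul]
  have htr : (sandwich Ct Q l * X⁻¹).trace = (Ct l * Q * Y⁻¹).trace := by
    rw [sandwich, ← hS, mul_assoc, mul_assoc, trace_mul_comm, mul_assoc, mul_assoc, hinv,
      ← mul_assoc S, hSS, mul_assoc]
  rw [response, htr]

end sandwich

section canonical
variable {r t L : ℕ} {σ : ℝ} {C : Fin L → Matrix (Fin r) (Fin r) ℂ}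
  {Ct : Fin L → Matrix (Fin t) (Fin t) ℂ} {Q Q' : Matrix (Fin t) (Fin t) ℂ}
  {p p' : (Fin L → ℝ) × (Fin L → ℝ)}

lemma ne_zero_of_mem_powerSet (hQ : Q ∈ powerSet t) : Q ≠ 0 := by
  rintro rfl
  simpa using hQ.2

lemma Matrix.PosDef.ne_zero_of_pos {n : ℕ} (hn : 0 < n) {A : Matrix (Fin n) (Fin n) ℂ}
    (hA : A.PosDef) : A ≠ 0 := by
  rintro rfl
  have := hA.diag_pos (i := ⟨0, hn⟩)
  simp at this

lemma isCanonicalSolution_iff (hσ : 0 < σ) (hC : ∀ l, (C l).PosDef) (hCt : ∀ l, (Ct l).PosDef) :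
    IsCanonicalSolution σ C Ct Q p ↔
      (∀ l, 0 < p.1 l) ∧ (∀ l, 0 < p.2 l) ∧ p.1 = response (σ ^ 2 * t)⁻¹ C p.2 ∧
        p.2 = response (σ ^ 2 * t)⁻¹ (sandwich Ct Q) p.1 := by
  unfold IsCanonicalSolution
  refine and_congr_right fun h1 => and_congr_right fun h2 => and_congr ?_ ?_
  · rw [funext_iff]
    refine forall_congr' fun l => ?_
    rw [fR_eq_response t hσ (fun l => (hC l).posSemidef) (fun l => (h2 l).le), Complex.ofReal_inj]
  · rw [funext_iff]
    refine forall_congr' fun l => ?_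
    have : fT σ Ct p.1 Q l = fR t σ (sandwich Ct Q) p.1 l := rfl
    rw [this, fR_eq_response t hσ (sandwich_posSemidef hCt) (fun l => (h1 l).le),
      Complex.ofReal_inj]

theorem existsUnique_isCanonicalSolution (hr : 0 < r) (ht : 0 < t) (hσ : 0 < σ)
    (hC : ∀ l, (C l).PosDef) (hCt : ∀ l, (Ct l).PosDef) (hQ : Q ∈ powerSet t) :
    ∃! p, IsCanonicalSolution σ C Ct Q p := by
  have hc : 0 < (σ ^ 2 * t)⁻¹ := inv_pos.mpr (mul_pos (pow_pos hσ 2) (Nat.cast_pos.mpr ht))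
  simp only [isCanonicalSolution_iff hσ hC hCt]
  exact (isAntitoneScalable_response hc (fun l => (hC l).posSemidef)
      fun l => (hC l).ne_zero_of_pos hr).existsUnique
    (isAntitoneScalable_response hc (sandwich_posSemidef hCt)
      (sandwich_ne_zero hCt hQ.1 (ne_zero_of_mem_powerSet hQ)))

lemma canonicalSolution_spec (hr : 0 < r) (ht : 0 < t) (hσ : 0 < σ)
    (hC : ∀ l, (C l).PosDef) (hCt : ∀ l, (Ct l).PosDef) (hQ : Q ∈ powerSet t) :
    IsCanonicalSolution σ C Ct Q (canonicalSolution σ C Ct Q) :=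
  Classical.epsilon_spec (existsUnique_isCanonicalSolution hr ht hσ hC hCt hQ).exists

/-! ### The saddle function and its comparison principle -/

/-- The function `V(κ, κ̃, Q) = log|I + C(κ̃)| + log|I + Q C̃(κ)| - σ² t ∑ₗ κₗ κ̃ₗ` at
`p = (κ, κ̃)`. The canonical system at `Q` says that `p` is a critical point of `V(·, ·, Q)`. -/
noncomputable def saddle (σ : ℝ) (C : Fin L → Matrix (Fin r) (Fin r) ℂ)
    (Ct : Fin L → Matrix (Fin t) (Fin t) ℂ) (p : (Fin L → ℝ) × (Fin L → ℝ))
    (Q : Matrix (Fin t) (Fin t) ℂ) : ℝ :=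
  logDet (1 + matComb C p.2) + logDet (1 + Q * matComb Ct p.1) - σ ^ 2 * t * ∑ l, p.1 l * p.2 l

/-- The comparison principle: if `p = (κ, κ̃)` solves the canonical system at `Q` and
`p' = (κ', κ̃')` solves it at any other matrix, then `V(p, Q) ≤ V(p', Q)`. -/
theorem saddle_le_saddle (ht : 0 < t) (hσ : 0 < σ)
    (hC : ∀ l, (C l).PosDef) (hCt : ∀ l, (Ct l).PosDef) (hQ : Q.PosSemidef)
    (hp : IsCanonicalSolution σ C Ct Q p) (hp' : IsCanonicalSolution σ C Ct Q' p') :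
    saddle σ C Ct p Q ≤ saddle σ C Ct p' Q := by
  obtain ⟨x, y⟩ := p
  obtain ⟨x', y'⟩ := p'
  obtain ⟨hx, hy, hxy, hyx⟩ := (isCanonicalSolution_iff hσ hC hCt).mp hp
  obtain ⟨hx', hy', hxy', -⟩ := (isCanonicalSolution_iff hσ hC hCt).mp hp'
  dsimp only at hx hy hxy hyx hx' hy' hxy'
  have hb : 0 < σ ^ 2 * (t : ℝ) := mul_pos (pow_pos hσ 2) (Nat.cast_pos.mpr ht)
  have hCs : ∀ l, (C l).PosSemidef := fun l => (hC l).posSemidef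
  -- `z = κ κ̃ / κ'` keeps the products `κₗ κ̃ₗ` fixed when `κ` is replaced by `κ'`
  have hz : 0 ≤ (x / x') * y := fun l => (mul_pos (div_pos (hx l) (hx' l)) (hy l)).le
  have h1 := le_logDet_matComb_mul hb (sandwich_posSemidef (Q := Q) hCt) (fun l => (hx l).le)
    (w := x' / x) fun l => div_pos (hx' l) (hx l)
  have h2 := le_logDet_matComb_mul hb hCs (fun l => (hy l).le)
    (w := x / x') fun l => div_pos (hx l) (hx' l)
  have h3 := logDet_matComb_le hb hCs (fun l => (hy' l).le) hz
  rw [← hyx] at h1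
  rw [← hxy] at h2
  rw [← hxy'] at h3
  have e0 : x' / x * x = x' := by
    funext l; exact div_mul_cancel₀ _ (hx l).ne'
  rw [e0] at h1
  have e1 : ∑ l, x l * y l * Real.log ((x' / x) l) + ∑ l, y l * x l * Real.log ((x / x') l) = 0 := by
    rw [← Finset.sum_add_distrib]
    refine Finset.sum_eq_zero fun l _ => ?_
    rw [Pi.div_apply, Pi.div_apply, Real.log_div (hx' l).ne' (hx l).ne',
      Real.log_div (hx l).ne' (hx' l).ne']
    ring
  have e2 : ∑ l, ((x / x' * y) l - y' l) * x' l = ∑ l, x l * y l - ∑ l, x' l * y' l := by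
    rw [← Finset.sum_sub_distrib]
    refine Finset.sum_congr rfl fun l _ => ?_
    have := (hx' l).ne'
    rw [Pi.mul_apply, Pi.div_apply]
    field_simp
  rw [e2, mul_sub] at h3
  have e3 := congrArg (σ ^ 2 * (t : ℝ) * ·) e1
  simp only [mul_add, mul_zero] at e3
  have d : ∀ κ : Fin L → ℝ,
      logDet (1 + Q * matComb Ct κ) = logDet (1 + matComb (sandwich Ct Q) κ) := fun κ => by
    rw [logDet, det_one_add_mul_eq hQ, logDet]
  simp only [saddle, d]
  linarith

end canonical

/-! ### Strict concavity in the covariance matrix -/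

lemma logDet_one_add_mul {t : ℕ} {Q B : Matrix (Fin t) (Fin t) ℂ} (hB : B.PosDef)
    (hQ : Q.PosSemidef) : logDet (1 + Q * B) = logDet (B⁻¹ + Q) + logDet B := by
  rw [← logDet_mul (hB.inv.add_posSemidef hQ).det_pos hB.det_pos, add_mul,
    nonsing_inv_mul B ((isUnit_iff_isUnit_det B).mp hB.isUnit)]

lemma convex_powerSet (t : ℕ) : Convex ℝ (powerSet t) := by
  intro Q hQ R hR a b ha hb hab
  refine ⟨(hQ.1.smul ha).add (hR.1.smul hb), ?_⟩
  have h : (a : ℂ) + b = 1 := by exact_mod_cast hab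
  rw [trace_add, trace_smul, trace_smul, mul_add, Complex.real_smul, Complex.real_smul]
  linear_combination a * hQ.2 + b * hR.2 + h

lemma strictConcaveOn_logDet {t : ℕ} {B : Matrix (Fin t) (Fin t) ℂ} (hB : B.PosDef) :
    StrictConcaveOn ℝ (powerSet t) fun Q => logDet (1 + Q * B) := by
  refine ⟨convex_powerSet t, fun Q hQ R hR hne a b ha hb hab => ?_⟩
  have hM := convex_powerSet t hQ hR ha.le hb.le hab
  set M := a • Q + b • R with hMdef
  have hQM : Q - M = b • (Q - R) := by
    have : a = 1 - b := by linarith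
    rw [hMdef, this]; module
  have hRM : R - M = (-a) • (Q - R) := by
    have : b = 1 - a := by linarith
    rw [hMdef, this]; module
  have hpd : ∀ {Q : Matrix (Fin t) (Fin t) ℂ}, Q ∈ powerSet t → (B⁻¹ + Q).PosDef :=
    fun h => hB.inv.add_posSemidef h.1
  have h1 := (hpd hM).logDet_lt_tangent (hpd hQ) fun h => hne <| by
    have h0 : Q - M = 0 := sub_eq_zero.mpr (add_left_cancel h)
    rw [hQM, smul_eq_zero_iff_right hb.ne'] at h0
    exact sub_eq_zero.mp h0
  have h2 := (hpd hM).logDet_le_tangent (hpd hR)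
  rw [add_sub_add_left_eq_sub, hQM, smul_mul_assoc, trace_smul, Complex.smul_re, smul_eq_mul] at h1
  rw [add_sub_add_left_eq_sub, hRM, smul_mul_assoc, trace_smul, Complex.smul_re, smul_eq_mul] at h2
  have h1' := mul_lt_mul_of_pos_left h1 ha
  have h2' := mul_le_mul_of_nonneg_left h2 hb.le
  simp only [logDet_one_add_mul hB hQ.1, logDet_one_add_mul hB hR.1, logDet_one_add_mul hB hM.1,
    smul_eq_mul]
  have e : logDet (B⁻¹ + M) + logDet B = (a + b) * (logDet (B⁻¹ + M) + logDet B) := by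
    rw [hab, one_mul]
  rw [e]
  nlinarith

/-! ### Compactness and continuity -/

/-- The factorization `Q = Kᴴ K` exhibits `𝒞₁` as a continuous image of the sphere
`∑ᵢⱼ |Kᵢⱼ|² = t`. -/
lemma isCompact_powerSet (t : ℕ) : IsCompact (powerSet t) := by
  let S : Set (Matrix (Fin t) (Fin t) ℂ) := {K | (1 / (t : ℂ)) * (Kᴴ * K).trace = 1}
  have himg : powerSet t = (fun K : Matrix (Fin t) (Fin t) ℂ => Kᴴ * K) '' S := by
    ext Q
    constructor
    · intro hQ
      have h := hQ.1.sqrt_mul_sqrt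
      have h2 : (CFC.sqrt Q)ᴴ * CFC.sqrt Q = Q := by rw [(sqrt_isHermitian Q).eq, h]
      exact ⟨CFC.sqrt Q, by simp only [S, Set.mem_ofPred_eq, h2]; exact hQ.2, h2⟩
    · rintro ⟨K, hK, rfl⟩
      exact ⟨posSemidef_conjTranspose_mul_self K, hK⟩
  have hcont : Continuous fun K : Matrix (Fin t) (Fin t) ℂ => Kᴴ * K :=
    continuous_id.matrix_conjTranspose.matrix_mul continuous_id
  have hclosed : IsClosed S :=
    isClosed_eq (continuous_const.mul hcont.matrix_trace) continuous_const
  have hbox : IsCompact (Set.univ.pi fun _ : Fin t => Set.univ.pi fun _ : Fin t =>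
      Metric.closedBall (0 : ℂ) (t + 1)) :=
    isCompact_univ_pi fun _ => isCompact_univ_pi fun _ => isCompact_closedBall _ _
  have hsub : S ⊆ Set.univ.pi fun _ : Fin t => Set.univ.pi fun _ : Fin t =>
      Metric.closedBall (0 : ℂ) (t + 1) := by
    intro K hK i _ j _
    have ht : (t : ℂ) ≠ 0 := by
      rintro h
      simp [S, h] at hK
    have h1 : (Kᴴ * K).trace = t := by
      have hK' : (1 / (t : ℂ)) * (Kᴴ * K).trace = 1 := hK
      field_simp at hK'
      exact hK'
    have h2 : ∑ j, ∑ i, ‖K i j‖ ^ 2 = (t : ℝ) := by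
      have h3 : (Kᴴ * K).trace = ((∑ j, ∑ i, ‖K i j‖ ^ 2 : ℝ) : ℂ) := by
        simp only [trace, diag_apply, mul_apply, conjTranspose_apply]
        push_cast
        refine Finset.sum_congr rfl fun j _ => Finset.sum_congr rfl fun i _ => ?_
        exact Complex.conj_mul' (K i j)
      rw [h3] at h1
      exact_mod_cast h1
    have h4 : ‖K i j‖ ^ 2 ≤ t := by
      rw [← h2]
      refine le_trans ?_ (Finset.single_le_sum
        (f := fun j => ∑ i, ‖K i j‖ ^ 2) (fun j _ => by positivity) (Finset.mem_univ j))
      exact Finset.single_le_sum (f := fun i => ‖K i j‖ ^ 2) (fun i _ => by positivity)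
        (Finset.mem_univ i)
    rw [mem_closedBall_zero_iff]
    nlinarith [norm_nonneg (K i j)]
  rw [himg]
  exact (hbox.of_isClosed_subset hclosed hsub).image hcont

lemma powerSet_nonempty {t : ℕ} (ht : 0 < t) : (powerSet t).Nonempty := by
  refine ⟨1, PosSemidef.one, ?_⟩
  have : (t : ℂ) ≠ 0 := by exact_mod_cast ht.ne'
  simp [this]

lemma continuous_matComb {n L : ℕ} (A : Fin L → Matrix (Fin n) (Fin n) ℂ) :
    Continuous (matComb A) :=
  continuous_finsetSum _ fun l _ =>
    (Complex.continuous_ofReal.comp (continuous_apply l)).smul continuous_const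

lemma continuousAt_logDet {n : ℕ} {X : Matrix (Fin n) (Fin n) ℂ} (hX : 0 < X.det) :
    ContinuousAt logDet X :=
  (Complex.continuous_re.comp continuous_id.matrix_det).continuousAt.log (re_pos_of_pos hX).ne'

lemma continuousAt_inv_of_det_ne_zero {n : ℕ} {X : Matrix (Fin n) (Fin n) ℂ} (hX : X.det ≠ 0) :
    ContinuousAt Inv.inv X := by
  refine continuousAt_matrix_inv X ?_
  rw [Ring.inverse_eq_inv']
  exact continuousAt_inv₀ hX

section limits
variable {r t L : ℕ} {σ : ℝ} {C : Fin L → Matrix (Fin r) (Fin r) ℂ}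
  {Ct : Fin L → Matrix (Fin t) (Fin t) ℂ} {Q R : Matrix (Fin t) (Fin t) ℂ}
  {p : (Fin L → ℝ) × (Fin L → ℝ)}

lemma continuousAt_response {n : ℕ} {A : Fin L → Matrix (Fin n) (Fin n) ℂ}
    (hA : ∀ l, (A l).PosSemidef) {κ : Fin L → ℝ} (hκ : 0 ≤ κ) (c : ℝ) :
    ContinuousAt (response c A) κ := by
  refine continuousAt_pi.mpr fun l => continuousAt_const.mul ?_
  have h1 : ContinuousAt (fun κ => (1 + matComb A κ)⁻¹) κ :=
    (continuousAt_inv_of_det_ne_zero (one_add_matComb_posDef hA hκ).det_pos.ne').comp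
      (f := fun κ => 1 + matComb A κ) (continuous_const.add (continuous_matComb A)).continuousAt
  have h2 : Continuous fun P : Matrix (Fin n) (Fin n) ℂ => (A l * P).trace.re :=
    Complex.continuous_re.comp (continuous_const.matrix_mul continuous_id).matrix_trace
  exact h2.continuousAt.comp (f := fun κ => (1 + matComb A κ)⁻¹) h1

lemma tendsto_response_sandwich (hCt : ∀ l, (Ct l).PosDef) {κ : ℕ → Fin L → ℝ}
    {κ₀ : Fin L → ℝ} (hκ : ∀ n, 0 ≤ κ n) (hκ₀ : 0 ≤ κ₀) (hlim : Tendsto κ atTop (𝓝 κ₀))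
    {Qs : ℕ → Matrix (Fin t) (Fin t) ℂ} (hQs : ∀ n, (Qs n).PosSemidef) (hQ : Q.PosSemidef)
    (hQlim : Tendsto Qs atTop (𝓝 Q)) (c : ℝ) :
    Tendsto (fun n => response c (sandwich Ct (Qs n)) (κ n)) atTop
      (𝓝 (response c (sandwich Ct Q) κ₀)) := by
  refine tendsto_pi_nhds.mpr fun l => ?_
  simp only [fun n => response_sandwich hCt (hQs n) (hκ n) c l, response_sandwich hCt hQ hκ₀ c l]
  refine Tendsto.const_mul c ?_
  have hdet : (1 + matComb Ct κ₀ * Q).det ≠ 0 := by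
    rw [det_one_add_mul_comm]
    exact (det_one_add_mul_pos hCt hQ hκ₀).ne'
  have h1 : Tendsto (fun n => 1 + matComb Ct (κ n) * Qs n) atTop (𝓝 (1 + matComb Ct κ₀ * Q)) :=
    tendsto_const_nhds.add ((((continuous_matComb Ct).tendsto κ₀).comp hlim).mul hQlim)
  have h2 := (continuousAt_inv_of_det_ne_zero hdet).tendsto.comp h1
  have h3 := (tendsto_const_nhds (x := Ct l)).mul hQlim |>.mul h2
  have h4 : Continuous fun P : Matrix (Fin t) (Fin t) ℂ => P.trace.re :=
    Complex.continuous_re.comp continuous_id.matrix_trace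
  exact (h4.tendsto _).comp h3

/-- Sequential continuity of `Q ↦ (δ(Q), δ̃(Q))` on `𝒞₁`, along a subsequence: `δ` stays in a
fixed box, and any limit point solves the limiting canonical system, hence is its unique
solution. -/
lemma exists_subseq_canonicalSolution_tendsto (hr : 0 < r) (ht : 0 < t) (hσ : 0 < σ)
    (hC : ∀ l, (C l).PosDef) (hCt : ∀ l, (Ct l).PosDef)
    {Qs : ℕ → Matrix (Fin t) (Fin t) ℂ} (hQs : ∀ n, Qs n ∈ powerSet t) (hQ : Q ∈ powerSet t)
    (hlim : Tendsto Qs atTop (𝓝 Q)) :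
    ∃ φ : ℕ → ℕ, StrictMono φ ∧ Tendsto (fun n => canonicalSolution σ C Ct (Qs (φ n))) atTop
      (𝓝 (canonicalSolution σ C Ct Q)) := by
  have hc : 0 < (σ ^ 2 * (t : ℝ))⁻¹ :=
    inv_pos.mpr (mul_pos (pow_pos hσ 2) (Nat.cast_pos.mpr ht))
  have hCs : ∀ l, (C l).PosSemidef := fun l => (hC l).posSemidef
  have hf := isAntitoneScalable_response hc hCs fun l => (hC l).ne_zero_of_pos hr
  have hg := isAntitoneScalable_response hc (sandwich_posSemidef (Q := Q) hCt)
      (sandwich_ne_zero hCt hQ.1 (ne_zero_of_mem_powerSet hQ))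
  have hsol := fun n => (isCanonicalSolution_iff hσ hC hCt).mp
    (canonicalSolution_spec hr ht hσ hC hCt (hQs n))
  set p := fun n => canonicalSolution σ C Ct (Qs n) with hp
  have hx0 : ∀ n, 0 ≤ (p n).1 := fun n l => ((hsol n).1 l).le
  have hy0 : ∀ n, 0 ≤ (p n).2 := fun n l => ((hsol n).2.1 l).le
  have hbox : ∀ n, (p n).1 ∈ Set.Icc 0 (response (σ ^ 2 * t)⁻¹ C 0) := fun n => by
    refine ⟨hx0 n, ?_⟩
    rw [(hsol n).2.2.1]
    exact hf.anti 0 _ le_rfl (hy0 n)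
  obtain ⟨x, hx, φ, hφ, hxlim⟩ := isCompact_Icc.tendsto_subseq hbox
  have hylim := tendsto_response_sandwich hCt (fun n => hx0 (φ n)) hx.1 hxlim
    (fun n => (hQs (φ n)).1) hQ.1 (hlim.comp hφ.tendsto_atTop) (σ ^ 2 * t)⁻¹
  set y := response (σ ^ 2 * t)⁻¹ (sandwich Ct Q) x with hy
  have hylim' : Tendsto (fun n => (p (φ n)).2) atTop (𝓝 y) :=
    hylim.congr fun n => (hsol (φ n)).2.2.2.symm
  have hypos := hg.pos x hx.1
  have hxlim' : Tendsto (fun n => (p (φ n)).1) atTop (𝓝 (response (σ ^ 2 * t)⁻¹ C y)) := by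
    have := (continuousAt_response hCs (fun l => (hypos l).le) (σ ^ 2 * t)⁻¹).tendsto.comp hylim'
    exact this.congr fun n => (hsol (φ n)).2.2.1.symm
  have hxy : x = response (σ ^ 2 * t)⁻¹ C y := tendsto_nhds_unique hxlim hxlim'
  have hxpos : ∀ l, 0 < x l := fun l => by
    rw [hxy]; exact hf.pos y (fun l => (hypos l).le) l
  have hlimsol : IsCanonicalSolution σ C Ct Q (x, y) :=
    (isCanonicalSolution_iff hσ hC hCt).mpr ⟨hxpos, hypos, hxy, rfl⟩
  have heq : canonicalSolution σ C Ct Q = (x, y) :=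
    (existsUnique_isCanonicalSolution hr ht hσ hC hCt hQ).unique
      (canonicalSolution_spec hr ht hσ hC hCt hQ) hlimsol
  refine ⟨φ, hφ, ?_⟩
  rw [heq]
  exact hxlim.prodMk_nhds hylim'

lemma continuousAt_saddle_left (hC : ∀ l, (C l).PosDef) (hCt : ∀ l, (Ct l).PosDef)
    (hQ : Q.PosSemidef) (hp1 : 0 ≤ p.1) (hp2 : 0 ≤ p.2) :
    ContinuousAt (fun p => saddle σ C Ct p Q) p := by
  refine ContinuousAt.sub (ContinuousAt.add ?_ ?_) ?_
  · exact (continuousAt_logDet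
      (one_add_matComb_posDef (fun l => (hC l).posSemidef) hp2).det_pos).comp
      (f := fun p : (Fin L → ℝ) × (Fin L → ℝ) => 1 + matComb C p.2)
      (continuous_const.add ((continuous_matComb C).comp continuous_snd)).continuousAt
  · exact (continuousAt_logDet (det_one_add_mul_pos hCt hQ hp1)).comp
      (f := fun p : (Fin L → ℝ) × (Fin L → ℝ) => 1 + Q * matComb Ct p.1)
      (continuous_const.add (continuous_const.matrix_mul
        ((continuous_matComb Ct).comp continuous_fst))).continuousAt
  · fun_prop

lemma continuousAt_saddle_right (hCt : ∀ l, (Ct l).PosDef) (hQ : Q.PosSemidef) (hp1 : 0 ≤ p.1) :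
    ContinuousAt (saddle σ C Ct p) Q := by
  refine ContinuousAt.sub (ContinuousAt.add continuousAt_const ?_) continuousAt_const
  exact (continuousAt_logDet (det_one_add_mul_pos hCt hQ hp1)).comp
    (f := fun Q => 1 + Q * matComb Ct p.1)
    (continuous_const.add (continuous_id.matrix_mul continuous_const)).continuousAt

/-! ### Maximizers of `Ī` -/

lemma strictConcaveOn_saddle (hL : 0 < L) (hCt : ∀ l, (Ct l).PosDef) (hp1 : ∀ l, 0 < p.1 l) :
    StrictConcaveOn ℝ (powerSet t) (saddle σ C Ct p) := by
  have h := ((strictConcaveOn_logDet (matComb_posDef hL hCt hp1)).add_const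
    (logDet (1 + matComb C p.2) - σ ^ 2 * t * ∑ l, p.1 l * p.2 l))
  have heq : saddle σ C Ct p = (fun Q => logDet (1 + Q * matComb Ct p.1)) +
      fun _ => logDet (1 + matComb C p.2) - σ ^ 2 * t * ∑ l, p.1 l * p.2 l := by
    funext Q
    simp only [saddle, Pi.add_apply]
    ring
  rw [heq]
  exact h

/-- By the comparison principle `Ī` is the minimum of the functions `V(p, ·)`, where `p` runs
through the solutions of the canonical systems. -/
lemma Ibar_le_saddle (hr : 0 < r) (ht : 0 < t) (hσ : 0 < σ)
    (hC : ∀ l, (C l).PosDef) (hCt : ∀ l, (Ct l).PosDef) (hQ : Q ∈ powerSet t)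
    (hR : R ∈ powerSet t) : Ibar σ C Ct Q ≤ saddle σ C Ct (canonicalSolution σ C Ct R) Q :=
  saddle_le_saddle ht hσ hC hCt hQ.1 (canonicalSolution_spec hr ht hσ hC hCt hQ)
    (canonicalSolution_spec hr ht hσ hC hCt hR)

/-- A minimum of strictly concave functions is strictly concave. -/
lemma strictConcaveOn_Ibar (hr : 0 < r) (ht : 0 < t) (hL : 0 < L) (hσ : 0 < σ)
    (hC : ∀ l, (C l).PosDef) (hCt : ∀ l, (Ct l).PosDef) :
    StrictConcaveOn ℝ (powerSet t) (Ibar σ C Ct) := by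
  refine ⟨convex_powerSet t, fun Q hQ R hR hne a b ha hb hab => ?_⟩
  have hM := convex_powerSet t hQ hR ha.le hb.le hab
  refine lt_of_le_of_lt ?_ ((strictConcaveOn_saddle (C := C) (σ := σ) hL hCt
    (canonicalSolution_spec hr ht hσ hC hCt hM).1).2 hQ hR hne ha hb hab)
  exact add_le_add (mul_le_mul_of_nonneg_left (Ibar_le_saddle hr ht hσ hC hCt hQ hM) ha.le)
    (mul_le_mul_of_nonneg_left (Ibar_le_saddle hr ht hσ hC hCt hR hM) hb.le)

lemma upperSemicontinuousOn_Ibar (hr : 0 < r) (ht : 0 < t) (hσ : 0 < σ)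
    (hC : ∀ l, (C l).PosDef) (hCt : ∀ l, (Ct l).PosDef) :
    UpperSemicontinuousOn (Ibar σ C Ct) (powerSet t) := by
  intro Q hQ v hv
  have hcont := continuousAt_saddle_right (σ := σ) (C := C) hCt hQ.1
    fun l => ((canonicalSolution_spec (σ := σ) hr ht hσ hC hCt hQ).1 l).le
  filter_upwards [nhdsWithin_le_nhds (hcont.eventually_lt_const hv), self_mem_nhdsWithin]
    with R hR hRm
  exact (Ibar_le_saddle hr ht hσ hC hCt hRm hQ).trans_lt hR

lemma StrictConcaveOn.isUniqueMaximizer {E : Type*} [AddCommGroup E] [Module ℝ E] {s : Set E}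
    {f : E → ℝ} (hf : StrictConcaveOn ℝ s f) {x : E} (hx : IsMaximizer f s x) :
    IsUniqueMaximizer f s x := by
  refine ⟨hx.1, fun y hy hne => lt_of_le_of_ne (hx.2 y hy) fun h => hne ?_⟩
  exact hf.eq_of_isMaxOn (fun z hz => by rw [Set.mem_ofPred_eq, h]; exact hx.2 z hz) hx.2 hy hx.1

/-- A maximizer `R` of `Ī` also maximizes `V(p, ·)` with `p = (δ(R), δ̃(R))` held fixed. This is a
first-order argument: on the segment `Rₛ = R + s (Q - R)`, with `pₛ = (δ(Rₛ), δ̃(Rₛ))`, concavity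
of `V(pₛ, ·)` bounds `V(pₛ, Q)` by `Ī(R)`, and `pₛ → p` as `s → 0`. -/
lemma isMaximizer_saddle_of_isMaximizer_Ibar (hr : 0 < r) (ht : 0 < t) (hL : 0 < L) (hσ : 0 < σ)
    (hC : ∀ l, (C l).PosDef) (hCt : ∀ l, (Ct l).PosDef)
    (hR : IsMaximizer (Ibar σ C Ct) (powerSet t) R) :
    IsMaximizer (saddle σ C Ct (canonicalSolution σ C Ct R)) (powerSet t) R := by
  refine ⟨hR.1, fun Q hQ => ?_⟩
  let s : ℕ → ℝ := fun n => 1 / (n + 1)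
  have hs0 : ∀ n, 0 < s n := fun n => Nat.one_div_pos_of_nat
  have hs1 : ∀ n, s n ≤ 1 := fun n => by
    simpa [s] using Nat.one_div_le_one_div (α := ℝ) (Nat.zero_le n)
  let Qs : ℕ → Matrix (Fin t) (Fin t) ℂ := fun n => (1 - s n) • R + s n • Q
  have hQs : ∀ n, Qs n ∈ powerSet t := fun n =>
    convex_powerSet t hR.1 hQ (sub_nonneg.mpr (hs1 n)) (hs0 n).le (sub_add_cancel _ _)
  have hs : Tendsto s atTop (𝓝 0) := tendsto_one_div_add_atTop_nhds_zero_nat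
  have hlim : Tendsto Qs atTop (𝓝 R) := by
    have := ((tendsto_const_nhds (x := (1 : ℝ))).sub hs).smul_const R |>.add (hs.smul_const Q)
    simpa using this
  obtain ⟨φ, -, hφ⟩ := exists_subseq_canonicalSolution_tendsto hr ht hσ hC hCt hQs hR.1 hlim
  have hbound : ∀ n, saddle σ C Ct (canonicalSolution σ C Ct (Qs n)) Q ≤ Ibar σ C Ct R := by
    intro n
    have h1 := (strictConcaveOn_saddle (C := C) (σ := σ) hL hCt
      (canonicalSolution_spec hr ht hσ hC hCt (hQs n)).1).concaveOn.2 hR.1 hQ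
      (sub_nonneg.mpr (hs1 n)) (hs0 n).le (sub_add_cancel _ _)
    have h2 := Ibar_le_saddle hr ht hσ hC hCt hR.1 (hQs n)
    have h3 : saddle σ C Ct (canonicalSolution σ C Ct (Qs n)) (Qs n) ≤ _ := hR.2 _ (hQs n)
    have h4 := mul_le_mul_of_nonneg_left h2 (sub_nonneg.mpr (hs1 n))
    simp only [smul_eq_mul] at h1
    have h5 := h1.trans h3
    refine le_of_mul_le_mul_left ?_ (hs0 n)
    linarith
  have hsol := canonicalSolution_spec hr ht hσ hC hCt hR.1
  have hcont := (continuousAt_saddle_left (σ := σ) hC hCt hQ.1 (fun l => (hsol.1 l).le)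
    fun l => (hsol.2.1 l).le).tendsto.comp hφ
  exact le_of_tendsto' hcont fun n => hbound (φ n)

end limits

theorem proposition1 {r t L : ℕ} (hr : 0 < r) (ht : 0 < t) (hL : 0 < L)
    (σ : ℝ) (hσ : 0 < σ)
    (C : Fin L → Matrix (Fin r) (Fin r) ℂ) (hC : ∀ l, (C l).PosDef)
    (Ct : Fin L → Matrix (Fin t) (Fin t) ℂ) (hCt : ∀ l, (Ct l).PosDef) :
    -- the functions `δ`, `δ̃` are well defined on `𝒞₁`
    (∀ Q ∈ powerSet t, ∃! p, IsCanonicalSolution σ C Ct Q p) ∧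
    -- the argmax of `Ī` over `𝒞₁` exists and is unique
    (∃ Qs, IsUniqueMaximizer (Ibar σ C Ct) (powerSet t) Qs) ∧
    -- it is the unique solution of the waterfilling problem attached to `δ_* = δ(Q̄_*)`
    ∀ Qs, IsMaximizer (Ibar σ C Ct) (powerSet t) Qs →
      IsUniqueMaximizer (fun Q => logDet (1 + Q * matComb Ct (delta σ C Ct Qs)))
        (powerSet t) Qs := by
  refine ⟨fun Q hQ => existsUnique_isCanonicalSolution hr ht hσ hC hCt hQ, ?_, fun R hR => ?_⟩
  · obtain ⟨R, hR, hmax⟩ := (upperSemicontinuousOn_Ibar hr ht hσ hC hCt).exists_isMaxOn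
      (powerSet_nonempty ht) (isCompact_powerSet t)
    exact ⟨R, (strictConcaveOn_Ibar hr ht hL hσ hC hCt).isUniqueMaximizer ⟨hR, hmax⟩⟩
  · have hδ := (canonicalSolution_spec hr ht hσ hC hCt hR.1).1
    refine (strictConcaveOn_logDet (matComb_posDef hL hCt hδ)).isUniqueMaximizer ⟨hR.1, ?_⟩
    intro Q hQ
    -- `V(p, ·)` and `log |I + (·) C̃(δ)|` differ by a constant
    have h := (isMaximizer_saddle_of_isMaximizer_Ibar hr ht hL hσ hC hCt hR).2 Q hQ
    simp only [saddle] at h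
    dsimp only
    linarith
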